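/- \textbf{Theorem (Inconsistent active variable selection for the Transfer Lasso).} Let $\beta^*\in\mathbb{R}^p$ ($p$ fixed), $S=\{j:\beta^*_j\neq 0\}$ and $\sigma>0$. For each sample size $n$ let $X=X_n\in\mathbb{R}^{n\times p}$ be a deterministic design matrix with rows $x_1,\dots,x_n$, and let $y=X\beta^*+\varepsilon$, where the entries of $\varepsilon=\varepsilon_n\in\mathbb{R}^n$ are i.i.d. $\mathcal N(0,\sigma^2)$. Assume that, as $n\to\infty$, $\frac1n X^\top X\to C$ with $C$ positive definite and $\frac1n\max_i\|x_i\|_2^2\to 0$. Let $m=m(n)$ be nonnegative integers, positive for all large $n$, with $n/m\to r_0$ for some $r_0\in[0,\infty)$, and let $\tilde\beta=\tilde\beta_n$ be a random vector in $\mathbb{R}^p$ (the initial estimator), independent of $\varepsilon_n$ for each $n$, such that $\sqrt m(\tilde\beta-\beta^*)$ converges in distribution (in particular, $\tilde\beta$ is $\sqrt m$-consistent). Let $\lambda_n,\eta_n\ge 0$ be real numbers and let $\hat\beta_n$ be a Transfer Lasso estimator, $$\hat\beta_n\in\operatorname*{arg\,min}_{\beta\in\mathbb{R}^p}\Big\{\frac1n\|y-X\beta\|_2^2+\frac{\lambda_n}{n}\sum_{j=1}^p|\beta_j|+\frac{\eta_n}{n}\sum_{j=1}^p|\beta_j-\tilde\beta_j|\Big\},\qquad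 \hat S_n=\{j:(\hat\beta_n)_j\neq 0\}.$$ Suppose that $\tilde\beta$ is inconsistent in active variable selection, that is, there is a constant $\tilde c$ with $\limsup_{n\to\infty}P(\{j:\tilde\beta_j\neq 0\}=S)\le\tilde c<1$. Suppose further that one of the following holds: (i) $\eta_n/\sqrt n\to\infty$ and $\lambda_n/\eta_n\to\rho_0$ with $0\le\rho_0<1$; (ii) $\lambda_n/\sqrt n\to\lambda_0$ and $\eta_n/\sqrt n\to\eta_0$ with $\lambda_0,\eta_0\in[0,\infty)$. Then the Transfer Lasso is inconsistent in active variable selection: there is a constant $c$ with $$\limsup_{n\to\infty}P(\hat S_n=S)\le c<1.$$ -/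

import Mathlib

open Filter Topology MeasureTheory ProbabilityTheory
open scoped NNReal ENNReal Matrix

/-- The objective function of the Transfer Lasso with `n` observations `(X, y)`, hyperparameters
`lam`, `eta` and initial estimator `b₀`:
`(1/n) ‖y - X β‖₂² + (lam/n) ∑ j, |β j| + (eta/n) ∑ j, |β j - b₀ j|`. -/
noncomputable def transferLassoObjective {n p : ℕ} (X : Matrix (Fin n) (Fin p) ℝ)
    (y : Fin n → ℝ) (lam eta : ℝ) (b₀ β : Fin p → ℝ) : ℝ :=
  (1 / (n : ℝ)) * ∑ i, (y i - (X *ᵥ β) i) ^ 2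
    + (lam / n) * ∑ j, |β j| + (eta / n) * ∑ j, |β j - b₀ j|

/-- `b` is a Transfer Lasso estimate: a global minimizer of the Transfer Lasso objective. -/
def IsTransferLasso {n p : ℕ} (X : Matrix (Fin n) (Fin p) ℝ)
    (y : Fin n → ℝ) (lam eta : ℝ) (b₀ b : Fin p → ℝ) : Prop :=
  ∀ β : Fin p → ℝ,
    transferLassoObjective X y lam eta b₀ b ≤ transferLassoObjective X y lam eta b₀ β

/-- The set of active variables `{j : β j ≠ 0}` of a parameter vector. -/
def activeSet {p : ℕ} (β : Fin p → ℝ) : Set (Fin p) := {j | β j ≠ 0}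

/-- A sequence of estimators `b n` of `βstar` is inconsistent in active variable selection:
`limsup P(activeSet (b n) = activeSet βstar) ≤ c` for a constant `c < 1`. -/
def InconsistentActiveSelection {Ω : Type*} [MeasurableSpace Ω] (P : Measure Ω) {p : ℕ}
    (b : ℕ → Ω → Fin p → ℝ) (βstar : Fin p → ℝ) : Prop :=
  ∃ c : ℝ≥0∞, c < 1 ∧
    limsup (fun n => P {ω | activeSet (b n ω) = activeSet βstar}) atTop ≤ c

/-- The entries of the noise vector `ε` are i.i.d. with law `N(0, σ²)`. -/
def IsIIDGaussianNoise {Ω : Type*} [MeasurableSpace Ω] (P : Measure Ω) {n : ℕ}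
    (σ : ℝ≥0) (ε : Ω → Fin n → ℝ) : Prop :=
  iIndepFun (fun i ω => ε ω i) P ∧ ∀ i, HasLaw (fun ω => ε ω i) (gaussianReal 0 (σ ^ 2)) P

/-- The design condition: `(1/n) Xᵀ X → C` with `C` positive definite, and
`(1/n) max_i ‖x_i‖₂² → 0`, where `x_i` is the `i`-th row of the `n × p` design matrix. -/
def DesignCondition {p : ℕ} (X : (n : ℕ) → Matrix (Fin n) (Fin p) ℝ)
    (C : Matrix (Fin p) (Fin p) ℝ) : Prop :=
  C.PosDef ∧
  Tendsto (fun n : ℕ => (1 / (n : ℝ)) • ((X n)ᵀ * X n)) atTop (𝓝 C) ∧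
  Tendsto (fun n : ℕ => (1 / (n : ℝ)) * ⨆ i : Fin n, ∑ j, (X n i j) ^ 2) atTop (𝓝 0)

/-- `eta n / √n → ∞` and `lam n / eta n → ρ₀` with `0 ≤ ρ₀ < 1`. -/
def RegimeI (lam eta : ℕ → ℝ) : Prop :=
  Tendsto (fun n : ℕ => eta n / √(n : ℝ)) atTop atTop ∧
  ∃ ρ₀ : ℝ, 0 ≤ ρ₀ ∧ ρ₀ < 1 ∧ Tendsto (fun n : ℕ => lam n / eta n) atTop (𝓝 ρ₀)

/-- `lam n / √n → lam₀ ≥ 0` and `eta n / √n → eta₀ ≥ 0`. -/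
def RegimeII (lam eta : ℕ → ℝ) : Prop :=
  (∃ lam₀ : ℝ, 0 ≤ lam₀ ∧ Tendsto (fun n : ℕ => lam n / √(n : ℝ)) atTop (𝓝 lam₀)) ∧
  ∃ eta₀ : ℝ, 0 ≤ eta₀ ∧ Tendsto (fun n : ℕ => eta n / √(n : ℝ)) atTop (𝓝 eta₀)

/-! In regime (i) the Transfer Lasso copies the initial estimator. Its correlations with the
residual at `βinit` are `Xᵀε - XᵀX(βinit - βstar)`, of order `√n` because `n/m` stays bounded, while
`eta - lam` is of larger order. `IsTransferLasso.eq_init` then gives `βhat = βinit` with probability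
tending to one, and inconsistency is inherited.

In regime (ii) no limit law of `βhat` is needed. Consistency of `βinit` makes it eventually detect
every active variable, so its failure in selection forces some `βstar j = 0`
(`exists_inactive_of_inconsistent`). First-order optimality in the direction `a = G⁻¹ eⱼ`, with `G =
XᵀX/n`, isolates coordinate `j` of the error. If `βhat j = 0`, this bounds the Gaussian variable `ε
⬝ᵥ X a`, of standard deviation of order `√n`, by a threshold of order at most `√n`; that event has
probability bounded away from one. -/

/-! ### Deterministic optimality conditions -/

/-- The Transfer Lasso objective, multiplied by the sample size. -/
lemma IsTransferLasso.mul_le {n p : ℕ} (hn : 0 < n) {X : Matrix (Fin n) (Fin p) ℝ}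
    {y : Fin n → ℝ} {lam eta : ℝ} {b₀ b : Fin p → ℝ} (hb : IsTransferLasso X y lam eta b₀ b)
    (β : Fin p → ℝ) :
    (y - X *ᵥ b) ⬝ᵥ (y - X *ᵥ b) + lam * ∑ j, |b j| + eta * ∑ j, |b j - b₀ j|
      ≤ (y - X *ᵥ β) ⬝ᵥ (y - X *ᵥ β) + lam * ∑ j, |β j| + eta * ∑ j, |β j - b₀ j| := by
  have key : ∀ v : Fin p → ℝ, (y - X *ᵥ v) ⬝ᵥ (y - X *ᵥ v) + lam * ∑ j, |v j|
      + eta * ∑ j, |v j - b₀ j| = n * transferLassoObjective X y lam eta b₀ v := by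
    intro v
    have hn' : (n : ℝ) ≠ 0 := by positivity
    simp only [transferLassoObjective, dotProduct, Pi.sub_apply, ← sq]
    field_simp
  rw [key, key]
  exact mul_le_mul_of_nonneg_left (hb β) (Nat.cast_nonneg n)

/-- Perturbing a Transfer Lasso estimate in a direction `h` does not decrease the objective. -/
lemma IsTransferLasso.perturb {n p : ℕ} (hn : 0 < n) {X : Matrix (Fin n) (Fin p) ℝ}
    {y : Fin n → ℝ} {lam eta : ℝ} (hlam : 0 ≤ lam) (heta : 0 ≤ eta) {b₀ b : Fin p → ℝ}
    (hb : IsTransferLasso X y lam eta b₀ b) (h : Fin p → ℝ) :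
    2 * ((y - X *ᵥ b) ⬝ᵥ (X *ᵥ h)) ≤ (X *ᵥ h) ⬝ᵥ (X *ᵥ h) + (lam + eta) * ∑ j, |h j| := by
  have h0 := hb.mul_le hn (b + h)
  have e : y - X *ᵥ (b + h) = (y - X *ᵥ b) - X *ᵥ h := by
    rw [Matrix.mulVec_add]; abel
  rw [e] at h0
  simp only [sub_dotProduct, dotProduct_sub, dotProduct_comm (X *ᵥ h) y,
    dotProduct_comm (X *ᵥ h) (X *ᵥ b)] at h0 ⊢
  have h1 : ∑ j, |(b + h) j| ≤ ∑ j, |b j| + ∑ j, |h j| := by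
    rw [← Finset.sum_add_distrib]
    exact Finset.sum_le_sum fun j _ => abs_add_le _ _
  have h2 : ∑ j, |(b + h) j - b₀ j| ≤ ∑ j, |b j - b₀ j| + ∑ j, |h j| := by
    rw [← Finset.sum_add_distrib]
    refine Finset.sum_le_sum fun j _ => ?_
    rw [Pi.add_apply, add_sub_right_comm]
    exact abs_add_le _ _
  have h3 := mul_le_mul_of_nonneg_left h1 hlam
  have h4 := mul_le_mul_of_nonneg_left h2 heta
  linarith

/-- First-order optimality of a Transfer Lasso estimate in a direction `a`. -/
lemma IsTransferLasso.two_mul_dotProduct_le {n p : ℕ} (hn : 0 < n) {X : Matrix (Fin n) (Fin p) ℝ}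
    {y : Fin n → ℝ} {lam eta : ℝ} (hlam : 0 ≤ lam) (heta : 0 ≤ eta) {b₀ b : Fin p → ℝ}
    (hb : IsTransferLasso X y lam eta b₀ b) (a : Fin p → ℝ) :
    2 * ((y - X *ᵥ b) ⬝ᵥ (X *ᵥ a)) ≤ (lam + eta) * ∑ j, |a j| := by
  -- Perturb by `t • a` and divide by `t`; letting `t → 0⁺` removes the quadratic term.
  have h0 : ∀ t : ℝ, 0 < t → 2 * ((y - X *ᵥ b) ⬝ᵥ (X *ᵥ a)) ≤
      t * ((X *ᵥ a) ⬝ᵥ (X *ᵥ a)) + (lam + eta) * ∑ j, |a j| := by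
    intro t ht
    have h1 := hb.perturb hn hlam heta (t • a)
    simp only [Matrix.mulVec_smul, dotProduct_smul, smul_dotProduct, smul_eq_mul,
      Pi.smul_apply, abs_mul, abs_of_pos ht, ← Finset.mul_sum] at h1
    refine le_of_mul_le_mul_left ?_ ht
    linarith
  have hlim : Tendsto (fun t : ℝ => t * ((X *ᵥ a) ⬝ᵥ (X *ᵥ a)) + (lam + eta) * ∑ j, |a j|)
      (𝓝[>] 0) (𝓝 (0 * ((X *ᵥ a) ⬝ᵥ (X *ᵥ a)) + (lam + eta) * ∑ j, |a j|)) :=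
    (Continuous.tendsto (by fun_prop) 0).mono_left nhdsWithin_le_nhds
  have := ge_of_tendsto hlim (eventually_mem_nhdsWithin.mono fun t ht => h0 t ht)
  linarith

lemma IsTransferLasso.two_mul_abs_dotProduct_le {n p : ℕ} (hn : 0 < n)
    {X : Matrix (Fin n) (Fin p) ℝ}
    {y : Fin n → ℝ} {lam eta : ℝ} (hlam : 0 ≤ lam) (heta : 0 ≤ eta) {b₀ b : Fin p → ℝ}
    (hb : IsTransferLasso X y lam eta b₀ b) (a : Fin p → ℝ) :
    2 * |(y - X *ᵥ b) ⬝ᵥ (X *ᵥ a)| ≤ (lam + eta) * ∑ j, |a j| := by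
  have h1 := hb.two_mul_dotProduct_le hn hlam heta a
  have h2 := hb.two_mul_dotProduct_le hn hlam heta (-a)
  simp only [Matrix.mulVec_neg, dotProduct_neg, Pi.neg_apply, abs_neg] at h2
  rcases abs_cases ((y - X *ᵥ b) ⬝ᵥ (X *ᵥ a)) with ⟨h, _⟩ | ⟨h, _⟩ <;> rw [h] <;> linarith

/-- When the correlation of the columns of `X` with the residual at the initial estimator is below
the threshold `eta - lam`, the Transfer Lasso returns the initial estimator. -/
lemma IsTransferLasso.eq_init {n p : ℕ} (hn : 0 < n) {X : Matrix (Fin n) (Fin p) ℝ}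
    {y : Fin n → ℝ} {lam eta : ℝ} (hlam : 0 ≤ lam) {b₀ b : Fin p → ℝ}
    (hb : IsTransferLasso X y lam eta b₀ b)
    (hlt : ∀ j, 2 * |(Xᵀ *ᵥ (y - X *ᵥ b₀)) j| < eta - lam) : b = b₀ := by
  obtain ⟨h, rfl⟩ : ∃ h, b = b₀ + h := ⟨b - b₀, by abel⟩
  have h0 := hb.mul_le hn b₀
  have e : y - X *ᵥ (b₀ + h) = (y - X *ᵥ b₀) - X *ᵥ h := by
    rw [Matrix.mulVec_add]; abel
  rw [e] at h0
  set r := y - X *ᵥ b₀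
  have hr : r ⬝ᵥ (X *ᵥ h) = ∑ j, (Xᵀ *ᵥ r) j * h j := by
    rw [Matrix.dotProduct_mulVec, Matrix.mulVec_transpose]; rfl
  simp only [sub_dotProduct, dotProduct_sub, dotProduct_comm (X *ᵥ h) r, hr] at h0
  have h1 : ∑ j, |b₀ j| ≤ ∑ j, |(b₀ + h) j| + ∑ j, |h j| := by
    rw [← Finset.sum_add_distrib]
    refine Finset.sum_le_sum fun j _ => ?_
    have := abs_add_le ((b₀ + h) j) (-h j)
    simpa using this
  have h2 : 0 ≤ (X *ᵥ h) ⬝ᵥ (X *ᵥ h) := by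
    simpa using dotProduct_star_self_nonneg (X *ᵥ h)
  have h3 := mul_le_mul_of_nonneg_left h1 hlam
  have h4 : ∑ j, ((eta - lam) * |h j| - 2 * ((Xᵀ *ᵥ r) j * h j)) ≤ 0 := by
    rw [Finset.sum_sub_distrib, ← Finset.mul_sum, ← Finset.mul_sum]
    simp only [Pi.add_apply, add_sub_cancel_left, sub_self, abs_zero, Finset.sum_const_zero] at *
    linarith
  -- The lower bounds are nonnegative with a sum at most zero, so each vanishes; strictness in `hlt`
  -- then forces `h j = 0`.
  have h5 : ∀ j, (eta - lam - 2 * |(Xᵀ *ᵥ r) j|) * |h j| ≤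
      (eta - lam) * |h j| - 2 * ((Xᵀ *ᵥ r) j * h j) := by
    intro j
    have := le_abs_self ((Xᵀ *ᵥ r) j * h j)
    rw [abs_mul] at this
    linarith
  have h6 : ∀ j, 0 ≤ (eta - lam - 2 * |(Xᵀ *ᵥ r) j|) * |h j| := fun j =>
    mul_nonneg (by linarith [hlt j]) (abs_nonneg _)
  have h7 := (Finset.sum_eq_zero_iff_of_nonneg fun j _ => h6 j).1
    (le_antisymm ((Finset.sum_le_sum fun j _ => h5 j).trans h4)
      (Finset.sum_nonneg fun j _ => h6 j))
  ext j
  have h8 := (mul_eq_zero.1 (h7 j (Finset.mem_univ j))).resolve_left (by linarith [hlt j])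
  simpa using h8

/-! ### Gaussian estimates -/

/-- A linear combination of the entries of the noise vector is a centred Gaussian variable. -/
lemma IsIIDGaussianNoise.hasLaw_dotProduct {Ω : Type*} [MeasurableSpace Ω] {P : Measure Ω}
    [IsProbabilityMeasure P] {n : ℕ} {σ : ℝ≥0} {ε : Ω → Fin n → ℝ} (hε : IsIIDGaussianNoise P σ ε)
    (c : Fin n → ℝ) :
    HasLaw (fun ω => ε ω ⬝ᵥ c) (gaussianReal 0 (σ ^ 2 * (c ⬝ᵥ c).toNNReal)) P := by
  have hlaw : ∀ i,
      HasLaw (fun ω => ε ω i * c i) (gaussianReal 0 (σ ^ 2 * (c i * c i).toNNReal)) P := by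
    intro i
    have h := gaussianReal_mul_const (hε.2 i) (c i)
    convert h using 2
    · simp
    · rw [mul_comm]
      congr 1
      ext
      simp [← sq, sq_nonneg]
  have hind : iIndepFun (fun i ω => ε ω i * c i) P :=
    hε.1.comp (fun i x => x * c i) (fun i => by fun_prop)
  have hs : ∀ s : Finset (Fin n), HasLaw (∑ i ∈ s, fun ω => ε ω i * c i)
      (gaussianReal 0 (σ ^ 2 * ∑ i ∈ s, (c i * c i).toNNReal)) P := by
    intro s
    induction s using Finset.induction_on with
    | empty =>
      refine ⟨by simp only [Finset.sum_empty]; exact aemeasurable_const, ?_⟩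
      simp only [Finset.sum_empty, mul_zero, gaussianReal_zero_var]
      change Measure.map (fun _ => (0 : ℝ)) P = _
      simp
    | insert i s hi ih =>
      rw [Finset.sum_insert hi, Finset.sum_insert hi, mul_add]
      have hI := (hind.indepFun_finsetSum_of_notMem₀ (fun i => (hlaw i).aemeasurable) hi).symm
      refine ⟨(hlaw i).aemeasurable.add ih.aemeasurable, ?_⟩
      have := gaussianReal_add_gaussianReal_of_indepFun hI (hlaw i).map_eq ih.map_eq
      simpa using this
  convert hs Finset.univ using 1
  · ext ω; simp [dotProduct]
  · rw [dotProduct, Real.toNNReal_sum_of_nonneg fun i _ => mul_self_nonneg _]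

lemma gaussianReal_zero_tail_le (v : ℝ≥0) {t : ℝ} (ht : 0 < t) :
    gaussianReal 0 v {x | t ≤ |x|} ≤ ENNReal.ofReal (v / t ^ 2) := by
  have := meas_ge_le_variance_div_sq (memLp_id_gaussianReal (μ := 0) (v := v) 2) ht
  simpa using this

/-- Lebesgue measure is absolutely continuous with respect to the Gaussian, so the complement, which
contains a half-line, cannot be null. -/
lemma gaussianReal_Icc_lt_one (M : ℝ) : gaussianReal 0 1 {x | |x| ≤ M} < 1 := by
  have hmeas : MeasurableSet {x : ℝ | |x| ≤ M} := measurableSet_le (by fun_prop) (by fun_prop)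
  refine lt_of_le_of_ne prob_le_one fun h => ?_
  have h0 := (prob_compl_eq_zero_iff hmeas).2 h
  have h1 := gaussianReal_absolutelyContinuous' 0 one_ne_zero h0
  have h2 : Set.Ioi |M| ⊆ {x : ℝ | |x| ≤ M}ᶜ := by
    intro x hx
    have := le_abs_self x
    have := le_abs_self M
    simp only [Set.mem_Ioi, Set.mem_compl_iff, Set.mem_ofPred_eq, not_le] at *
    linarith
  have h3 := measure_mono_null h2 h1
  simp at h3

/-! ### Tightness and transfer of selection inconsistency -/

/-- Sequences converging in distribution are tight: they exceed diverging thresholds with vanishing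
probability. -/
lemma TendstoInDistribution.tendsto_measure_norm_ge {Ω Ω' E : Type*} [MeasurableSpace Ω]
    [MeasurableSpace Ω'] [NormedAddCommGroup E] [MeasurableSpace E] [BorelSpace E]
    {P : Measure Ω} [IsProbabilityMeasure P] {P' : Measure Ω'} [IsProbabilityMeasure P']
    {T : ℕ → Ω → E} {Z : Ω' → E} (hT : TendstoInDistribution T atTop Z (fun _ => P) P')
    {t : ℕ → ℝ} (ht : Tendsto t atTop atTop) :
    Tendsto (fun n => P {ω | t n ≤ ‖T n ω‖}) atTop (𝓝 0) := by
  have hcl : ∀ M : ℝ, IsClosed {x : E | M ≤ ‖x‖} := fun M => isClosed_le (by fun_prop) (by fun_prop)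
  have hlim : Tendsto (fun k : ℕ => P'.map Z {x | (k : ℝ) ≤ ‖x‖}) atTop (𝓝 0) := by
    have : IsProbabilityMeasure (P'.map Z) := Measure.isProbabilityMeasure_map hT.aemeasurable_limit
    have hI : ⋂ k : ℕ, {x : E | (k : ℝ) ≤ ‖x‖} = ∅ := by
      ext x
      obtain ⟨k, hk⟩ := exists_nat_gt ‖x‖
      simp only [Set.mem_iInter, Set.mem_ofPred_eq, Set.mem_empty_iff_false, iff_false, not_forall]
      exact ⟨k, not_le.2 hk⟩
    have := tendsto_measure_iInter_atTop (μ := P'.map Z) (s := fun k : ℕ => {x : E | (k : ℝ) ≤ ‖x‖})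
      (fun k => (hcl k).measurableSet.nullMeasurableSet)
      (fun a b hab x (hx : (b : ℝ) ≤ ‖x‖) => (Nat.cast_le.2 hab).trans hx) ⟨0, measure_ne_top _ _⟩
    rwa [hI, measure_empty] at this
  rw [ENNReal.tendsto_nhds_zero]
  intro δ hδ
  -- The portmanteau bound only gives `limsup ≤ δ'`; the gap below `δ` turns it into an eventual
  -- inequality.
  obtain ⟨δ', hδ'0, hδ'⟩ := exists_between hδ
  obtain ⟨k, hk⟩ := ((ENNReal.tendsto_nhds_zero.1 hlim) δ' hδ'0).exists
  have h1 := ProbabilityMeasure.limsup_measure_closed_le_of_tendsto hT.tendsto (hcl k)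
  have h2 : limsup (fun n => P.map (T n) {x : E | (k : ℝ) ≤ ‖x‖}) atTop < δ :=
    lt_of_le_of_lt (h1.trans hk) hδ'
  filter_upwards [eventually_lt_of_limsup_lt h2, ht.eventually_ge_atTop (k : ℝ)] with n hn htn
  rw [Measure.map_apply_of_aemeasurable (hT.forall_aemeasurable n) (hcl k).measurableSet] at hn
  exact (measure_mono fun ω hω => le_trans htn hω).trans hn.le

/-- Finiteness of `r₀` makes the rate `√m` at least of order `√n`. -/
lemma eventually_natCast_le_mul {m : ℕ → ℕ} (hm : ∀ᶠ n in atTop, 0 < m n) {r₀ : ℝ}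
    (hmr : Tendsto (fun n : ℕ => (n : ℝ) / (m n : ℝ)) atTop (𝓝 r₀)) :
    ∀ᶠ n : ℕ in atTop, (n : ℝ) ≤ (r₀ + 1) * m n := by
  filter_upwards [hm, hmr.eventually_le_const (lt_add_one r₀)] with n hn h
  rwa [div_le_iff₀ (Nat.cast_pos.2 hn)] at h

lemma tendsto_sqrt_sourceSize {m : ℕ → ℕ} (hm : ∀ᶠ n in atTop, 0 < m n) {r₀ : ℝ} (hr₀ : 0 ≤ r₀)
    (hmr : Tendsto (fun n : ℕ => (n : ℝ) / (m n : ℝ)) atTop (𝓝 r₀)) :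
    Tendsto (fun n => √(m n : ℝ)) atTop atTop := by
  refine Real.tendsto_sqrt_atTop.comp ?_
  refine tendsto_atTop_mono' _ ?_
    (tendsto_natCast_atTop_atTop.atTop_div_const (by positivity : 0 < r₀ + 1))
  filter_upwards [eventually_natCast_le_mul hm hmr] with n hn
  rw [div_le_iff₀ (by positivity)]
  linarith

/-- An estimator that is inconsistent in active variable selection but consistent at a diverging
rate can only estimate a parameter with an inactive variable. -/
lemma exists_inactive_of_inconsistent {Ω Ω' : Type*} [MeasurableSpace Ω] [MeasurableSpace Ω']
    {P : Measure Ω} [IsProbabilityMeasure P] {P' : Measure Ω'} [IsProbabilityMeasure P']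
    {p : ℕ} {βstar : Fin p → ℝ} {a : ℕ → ℝ} (ha : Tendsto a atTop atTop)
    {b : ℕ → Ω → Fin p → ℝ} {Z : Ω' → Fin p → ℝ}
    (hZ : TendstoInDistribution (fun n ω => a n • (b n ω - βstar)) atTop Z (fun _ => P) P')
    (hb : InconsistentActiveSelection P b βstar) : ∃ j, βstar j = 0 := by
  by_contra! hne
  obtain ⟨c, hc, hlim⟩ := hb
  have h1 : Tendsto (fun n => ∑ j, P {ω | a n * |βstar j| ≤ ‖a n • (b n ω - βstar)‖}) atTop
      (𝓝 0) := by
    have := tendsto_finsetSum (Finset.univ : Finset (Fin p)) fun j _ =>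
      TendstoInDistribution.tendsto_measure_norm_ge hZ
        (ha.atTop_mul_const (abs_pos.2 (hne j)))
    simpa using this
  have h2 : limsup (fun n => P {ω | activeSet (b n ω) = activeSet βstar} +
      ∑ j, P {ω | a n * |βstar j| ≤ ‖a n • (b n ω - βstar)‖}) atTop < 1 := by
    refine lt_of_le_of_lt ?_ hc
    exact (ENNReal.limsup_add_of_right_tendsto_zero h1 _).trans_le hlim
  obtain ⟨n, hn, han⟩ := ((eventually_lt_of_limsup_lt h2).and (ha.eventually_ge_atTop 0)).exists
  -- Missing an active variable `j` costs an error of at least `|βstar j|`, so correct selection and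
  -- these large-error events cover the whole space.
  refine absurd hn (not_lt.2 ?_)
  calc (1 : ℝ≥0∞) = P Set.univ := measure_univ.symm
    _ ≤ P ({ω | activeSet (b n ω) = activeSet βstar} ∪
        ⋃ j, {ω | a n * |βstar j| ≤ ‖a n • (b n ω - βstar)‖}) := by
      refine measure_mono fun ω _ => ?_
      by_cases hω : ∃ j, b n ω j = 0
      · obtain ⟨j, hj⟩ := hω
        refine Or.inr (Set.mem_iUnion.2 ⟨j, ?_⟩)
        rw [Set.mem_ofPred_eq, norm_smul, Real.norm_of_nonneg han]
        refine mul_le_mul_of_nonneg_left ?_ han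
        simpa [hj] using norm_le_pi_norm (b n ω - βstar) j
      · push Not at hω
        refine Or.inl ?_
        ext j
        simp [activeSet, hω j, hne j]
    _ ≤ _ := (measure_union_le _ _).trans (by gcongr; exact measure_iUnion_fintype_le _ _)

/-- An estimator which agrees with an inconsistent one with probability tending to one is itself
inconsistent. -/
lemma InconsistentActiveSelection.of_tendsto_measure_ne {Ω : Type*} [MeasurableSpace Ω]
    {P : Measure Ω} {p : ℕ} {βstar : Fin p → ℝ} {b b' : ℕ → Ω → Fin p → ℝ}
    (hb : InconsistentActiveSelection P b βstar)
    (h : Tendsto (fun n => P {ω | b' n ω ≠ b n ω}) atTop (𝓝 0)) :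
    InconsistentActiveSelection P b' βstar := by
  obtain ⟨c, hc, hlim⟩ := hb
  refine ⟨c, hc, ?_⟩
  calc limsup (fun n => P {ω | activeSet (b' n ω) = activeSet βstar}) atTop
      ≤ limsup (fun n => P {ω | activeSet (b n ω) = activeSet βstar} +
          P {ω | b' n ω ≠ b n ω}) atTop := by
        refine limsup_le_limsup (Eventually.of_forall fun n => ?_)
        refine (measure_mono fun ω hω => ?_).trans (measure_union_le _ _)
        by_cases e : b' n ω = b n ω
        · left
          rw [Set.mem_ofPred_eq] at hω ⊢
          rwa [← e]
        · exact Or.inr e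
    _ ≤ _ := (ENNReal.limsup_add_of_right_tendsto_zero h _).trans_le hlim

/-! ### Regime (i): collapse onto the initial estimator -/

lemma tendsto_gram_apply {p : ℕ} {X : (n : ℕ) → Matrix (Fin n) (Fin p) ℝ}
    {C : Matrix (Fin p) (Fin p) ℝ} (hX : DesignCondition X C) (i j : Fin p) :
    Tendsto (fun n : ℕ => ((1 / (n : ℝ)) • ((X n)ᵀ * X n)) i j) atTop (𝓝 (C i j)) :=
  tendsto_pi_nhds.1 (tendsto_pi_nhds.1 hX.2.1 i) j

lemma RegimeI.tendsto_sub_div_sqrt {lam eta : ℕ → ℝ} (h : RegimeI lam eta) :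
    Tendsto (fun n : ℕ => (eta n - lam n) / √(n : ℝ)) atTop atTop := by
  obtain ⟨h1, ρ, -, hρ, h2⟩ := h
  have h3 := h1.atTop_mul_pos (sub_pos.2 hρ) (h2.const_sub 1)
  refine h3.congr' ?_
  filter_upwards [h1.eventually_gt_atTop 0] with n hn
  have : eta n ≠ 0 := by rintro h; simp [h] at hn
  field_simp

/-- The correlations of the noise with the columns of the design are of order `√n`. -/
lemma tendsto_measure_noise_correlation {Ω : Type*} [MeasurableSpace Ω] {P : Measure Ω}
    [IsProbabilityMeasure P] {p : ℕ} {σ : ℝ≥0} {X : (n : ℕ) → Matrix (Fin n) (Fin p) ℝ}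
    {C : Matrix (Fin p) (Fin p) ℝ} (hX : DesignCondition X C) {ε : (n : ℕ) → Ω → Fin n → ℝ}
    (hε : ∀ n, IsIIDGaussianNoise P σ (ε n)) {τ : ℕ → ℝ}
    (hτ : Tendsto (fun n : ℕ => τ n / √(n : ℝ)) atTop atTop) (j : Fin p) :
    Tendsto (fun n => P {ω | τ n ≤ |((X n)ᵀ *ᵥ ε n ω) j|}) atTop (𝓝 0) := by
  -- This is Chebyshev's bound: the variance is `σ² n` times the diagonal Gram entry, divided here
  -- by `τ²`.
  have h1 : Tendsto (fun n : ℕ => ENNReal.ofReal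
      (σ ^ 2 * ((1 / (n : ℝ)) • ((X n)ᵀ * X n)) j j / (τ n / √(n : ℝ)) ^ 2)) atTop (𝓝 0) := by
    rw [← ENNReal.ofReal_zero]
    exact ENNReal.tendsto_ofReal (((tendsto_gram_apply hX j j).const_mul _).div_atTop
      ((tendsto_pow_atTop two_ne_zero).comp hτ))
  refine tendsto_of_tendsto_of_tendsto_of_le_of_le' tendsto_const_nhds h1
    (Eventually.of_forall fun _ => zero_le) ?_
  filter_upwards [hτ.eventually_gt_atTop 0, eventually_gt_atTop 0] with n hn hn0
  have hn' : (0 : ℝ) < n := Nat.cast_pos.2 hn0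
  have hs : 0 < √(n : ℝ) := Real.sqrt_pos.2 hn'
  have hτn : 0 < τ n := by
    have := mul_pos hn hs
    rwa [div_mul_cancel₀ _ hs.ne'] at this
  have hl := (hε n).hasLaw_dotProduct (fun i => X n i j)
  have hm : MeasurableSet {x : ℝ | τ n ≤ |x|} := measurableSet_le (by fun_prop) (by fun_prop)
  have e : {ω | τ n ≤ |((X n)ᵀ *ᵥ ε n ω) j|} =
      (fun ω => ε n ω ⬝ᵥ fun i => X n i j) ⁻¹' {x : ℝ | τ n ≤ |x|} := by
    ext ω
    simp [Matrix.mulVec, dotProduct, mul_comm]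
  rw [e, ← Measure.map_apply_of_aemeasurable hl.aemeasurable hm, hl.map_eq]
  refine (gaussianReal_zero_tail_le _ hτn).trans (le_of_eq ?_)
  congr 1
  have h0 : 0 ≤ (fun i => X n i j) ⬝ᵥ (fun i => X n i j) := by
    simpa using dotProduct_star_self_nonneg (fun i => X n i j)
  rw [div_pow, Real.sq_sqrt hn'.le, NNReal.coe_mul, Real.coe_toNNReal _ h0]
  simp only [Matrix.smul_apply, Matrix.mul_apply, Matrix.transpose_apply, smul_eq_mul,
    dotProduct, NNReal.coe_pow]
  field_simp

/-- When `eta` dominates, the Transfer Lasso returns the initial estimator with probability tending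
to one. -/
lemma tendsto_measure_transferLasso_ne_init
    {Ω Ω' : Type*} [MeasurableSpace Ω] [MeasurableSpace Ω']
    {P : Measure Ω} [IsProbabilityMeasure P] {P' : Measure Ω'} [IsProbabilityMeasure P']
    {p : ℕ} {βstar : Fin p → ℝ} {σ : ℝ≥0}
    {X : (n : ℕ) → Matrix (Fin n) (Fin p) ℝ} {C : Matrix (Fin p) (Fin p) ℝ}
    (hX : DesignCondition X C)
    {ε : (n : ℕ) → Ω → Fin n → ℝ} (hε : ∀ n, IsIIDGaussianNoise P σ (ε n))
    {y : (n : ℕ) → Ω → Fin n → ℝ} (hy : ∀ n ω, y n ω = X n *ᵥ βstar + ε n ω)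
    {m : ℕ → ℕ} (hm : ∀ᶠ n in atTop, 0 < m n) {r₀ : ℝ} (hr₀ : 0 ≤ r₀)
    (hmr : Tendsto (fun n : ℕ => (n : ℝ) / (m n : ℝ)) atTop (𝓝 r₀))
    {βinit : ℕ → Ω → Fin p → ℝ} {Z : Ω' → Fin p → ℝ}
    (hZ : TendstoInDistribution
      (fun n ω => √(m n : ℝ) • (βinit n ω - βstar)) atTop Z (fun _ => P) P')
    {lam eta : ℕ → ℝ} (hlam : ∀ n, 0 ≤ lam n) {βhat : ℕ → Ω → Fin p → ℝ}
    (hβhat : ∀ n ω, IsTransferLasso (X n) (y n ω) (lam n) (eta n) (βinit n ω) (βhat n ω))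
    (hI : RegimeI lam eta) :
    Tendsto (fun n => P {ω | βhat n ω ≠ βinit n ω}) atTop (𝓝 0) := by
  have hτ := hI.tendsto_sub_div_sqrt
  -- `K` bounds the sup-norm operator norm of the Gram matrix.
  obtain ⟨K, hK, hCK⟩ : ∃ K : ℝ, 0 < K ∧ ∀ᶠ n : ℕ in atTop, ∀ j : Fin p,
      ∑ k, |((1 / (n : ℝ)) • ((X n)ᵀ * X n)) j k| ≤ K := by
    refine ⟨∑ j, ∑ k, |C j k| + 1, by positivity, ?_⟩
    refine eventually_all.2 fun j => ?_
    have h1 : Tendsto (fun n : ℕ => ∑ k, |((1 / (n : ℝ)) • ((X n)ᵀ * X n)) j k|) atTop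
        (𝓝 (∑ k, |C j k|)) :=
      tendsto_finsetSum _ fun k _ => (tendsto_gram_apply hX j k).abs
    refine h1.eventually_le_const (lt_of_le_of_lt ?_ (lt_add_one _))
    exact Finset.single_le_sum (f := fun j => ∑ k, |C j k|)
      (fun i _ => Finset.sum_nonneg fun _ _ => abs_nonneg _) (Finset.mem_univ j)
  set R := √(r₀ + 1)
  have hR : 0 < R := Real.sqrt_pos.2 (by positivity)
  -- If the optimality threshold `(eta - lam)/2` is reached, the noise or the initial error
  -- contributes at least half of it; `R` and `K` convert the latter into a bound on `√m ‖βinit -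
  -- βstar‖`.
  have hA := TendstoInDistribution.tendsto_measure_norm_ge hZ
    (hτ.atTop_div_const (by positivity : 0 < 4 * R * K))
  have hτ4 : Tendsto (fun n : ℕ => (eta n - lam n) / 4 / √(n : ℝ)) atTop atTop :=
    (hτ.atTop_div_const (by norm_num : (0 : ℝ) < 4)).congr fun n => div_right_comm _ _ _
  have hB := tendsto_finsetSum (Finset.univ : Finset (Fin p)) fun j _ =>
    tendsto_measure_noise_correlation hX hε hτ4 j
  have hAB := hA.add hB
  rw [Finset.sum_const_zero, add_zero] at hAB
  refine tendsto_of_tendsto_of_tendsto_of_le_of_le' tendsto_const_nhds hAB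
    (Eventually.of_forall fun _ => zero_le) ?_
  filter_upwards [hCK, eventually_natCast_le_mul hm hmr, eventually_gt_atTop 0] with n hCn hmn hn
  have hn' : (0 : ℝ) < n := Nat.cast_pos.2 hn
  have hs : 0 < √(n : ℝ) := Real.sqrt_pos.2 hn'
  have hsm : √(n : ℝ) ≤ R * √(m n : ℝ) := by
    rw [← Real.sqrt_mul (by positivity)]
    exact Real.sqrt_le_sqrt hmn
  refine (measure_mono (t := {ω | (eta n - lam n) / √(n : ℝ) / (4 * R * K) ≤
      ‖√(m n : ℝ) • (βinit n ω - βstar)‖} ∪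
      ⋃ j, {ω | (eta n - lam n) / 4 ≤ |((X n)ᵀ *ᵥ ε n ω) j|}) fun ω hω => ?_).trans
    ((measure_union_le _ _).trans (by gcongr; exact measure_iUnion_fintype_le _ _))
  obtain ⟨j, hj⟩ : ∃ j, eta n - lam n ≤
      2 * |((X n)ᵀ *ᵥ (y n ω - X n *ᵥ βinit n ω)) j| := by
    by_contra! hlt
    exact hω ((hβhat n ω).eq_init hn (hlam n) hlt)
  set d := βinit n ω - βstar
  have hres : ((X n)ᵀ *ᵥ (y n ω - X n *ᵥ βinit n ω)) j =
      ((X n)ᵀ *ᵥ ε n ω) j - n * (((1 / (n : ℝ)) • ((X n)ᵀ * X n)) *ᵥ d) j := by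
    have e1 : y n ω - X n *ᵥ βinit n ω = ε n ω - X n *ᵥ d := by
      rw [hy, Matrix.mulVec_sub]; abel
    rw [e1, Matrix.mulVec_sub, Matrix.mulVec_mulVec, Matrix.smul_mulVec]
    simp only [Pi.sub_apply, Pi.smul_apply, smul_eq_mul]
    field_simp
  have hCd : |(((1 / (n : ℝ)) • ((X n)ᵀ * X n)) *ᵥ d) j| ≤ K * ‖d‖ := by
    rw [Matrix.mulVec, dotProduct]
    refine (Finset.abs_sum_le_sum_abs _ _).trans ?_
    refine le_trans ?_ (mul_le_mul_of_nonneg_right (hCn j) (norm_nonneg d))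
    rw [Finset.sum_mul]
    refine Finset.sum_le_sum fun k _ => ?_
    rw [abs_mul]
    exact mul_le_mul_of_nonneg_left (norm_le_pi_norm d k) (abs_nonneg _)
  by_cases hbig : (eta n - lam n) / 4 ≤ |((X n)ᵀ *ᵥ ε n ω) j|
  · exact Or.inr (Set.mem_iUnion.2 ⟨j, hbig⟩)
  · refine Or.inl ?_
    have h1 : |((X n)ᵀ *ᵥ (y n ω - X n *ᵥ βinit n ω)) j| ≤
        |((X n)ᵀ *ᵥ ε n ω) j| + n * (K * ‖d‖) := by
      rw [hres]
      refine (abs_sub _ _).trans ?_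
      rw [abs_mul, abs_of_pos hn']
      gcongr
    have h2 : eta n - lam n ≤ 4 * (n * (K * ‖d‖)) := by linarith
    rw [Set.mem_ofPred_eq, norm_smul, Real.norm_of_nonneg (Real.sqrt_nonneg _), div_div,
      div_le_iff₀ (by positivity)]
    calc eta n - lam n ≤ 4 * (n * (K * ‖d‖)) := h2
      _ = (√(n : ℝ) * K * ‖d‖ * 4) * √(n : ℝ) := by
        nth_rewrite 1 [← Real.mul_self_sqrt hn'.le]
        ring
      _ ≤ (√(n : ℝ) * K * ‖d‖ * 4) * (R * √(m n : ℝ)) := by gcongr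
      _ = _ := by ring

/-! ### Regime (ii): an inactive variable is retained with positive probability -/

lemma gaussianReal_zero_abs_le {v : ℝ≥0} (hv : v ≠ 0) (B : ℝ) :
    gaussianReal 0 v {x | |x| ≤ B} = gaussianReal 0 1 {x | |x| ≤ B / √(v : ℝ)} := by
  have hs : 0 < √(v : ℝ) := Real.sqrt_pos.2 (NNReal.coe_pos.2 (pos_iff_ne_zero.2 hv))
  have h := gaussianReal_map_const_mul (μ := 0) (v := 1) √(v : ℝ)
  have e : NNReal.mk (√(v : ℝ) ^ 2) (sq_nonneg _) * 1 = v := by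
    ext
    simp
  rw [mul_zero, e] at h
  rw [← h, Measure.map_apply (by fun_prop) (measurableSet_le (by fun_prop) (by fun_prop))]
  congr 1
  ext x
  simp only [Set.mem_preimage, Set.mem_ofPred_eq, abs_mul, abs_of_pos hs, le_div_iff₀ hs]
  rw [mul_comm]

/-- Determinant and adjugate are continuous, and the limiting determinant is nonzero. -/
lemma DesignCondition.tendsto_inv {p : ℕ} {X : (n : ℕ) → Matrix (Fin n) (Fin p) ℝ}
    {C : Matrix (Fin p) (Fin p) ℝ} (hX : DesignCondition X C) :
    Tendsto (fun n : ℕ => ((1 / (n : ℝ)) • ((X n)ᵀ * X n))⁻¹) atTop (𝓝 C⁻¹) := by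
  simp only [Matrix.inv_def, Ring.inverse_eq_inv']
  refine Tendsto.smul (Tendsto.inv₀ ?_ hX.1.det_pos.ne') ?_
  · exact ((continuous_id.matrix_det).tendsto C).comp hX.2.1
  · exact ((continuous_id.matrix_adjugate).tendsto C).comp hX.2.1

/-- If some variable is inactive and the penalties are of order `√n`, the Transfer Lasso is
inconsistent in active variable selection: the inactive variable can only be excluded when a
Gaussian noise variable of order `√n` falls below a threshold of the same order. -/
lemma inconsistent_of_regimeII {Ω : Type*} [MeasurableSpace Ω]
    {P : Measure Ω} [IsProbabilityMeasure P]
    {p : ℕ} {βstar : Fin p → ℝ} {σ : ℝ≥0} (hσ : 0 < σ)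
    {X : (n : ℕ) → Matrix (Fin n) (Fin p) ℝ} {C : Matrix (Fin p) (Fin p) ℝ}
    (hX : DesignCondition X C)
    {ε : (n : ℕ) → Ω → Fin n → ℝ} (hε : ∀ n, IsIIDGaussianNoise P σ (ε n))
    {y : (n : ℕ) → Ω → Fin n → ℝ} (hy : ∀ n ω, y n ω = X n *ᵥ βstar + ε n ω)
    {βinit : ℕ → Ω → Fin p → ℝ}
    {lam eta : ℕ → ℝ} (hlam : ∀ n, 0 ≤ lam n) (heta : ∀ n, 0 ≤ eta n)
    {βhat : ℕ → Ω → Fin p → ℝ}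
    (hβhat : ∀ n ω, IsTransferLasso (X n) (y n ω) (lam n) (eta n) (βinit n ω) (βhat n ω))
    (hII : RegimeII lam eta) {j : Fin p} (hj : βstar j = 0) :
    InconsistentActiveSelection P βhat βstar := by
  obtain ⟨⟨l, -, hl⟩, e, -, he⟩ := hII
  set G : ℕ → Matrix (Fin p) (Fin p) ℝ := fun n => (1 / (n : ℝ)) • ((X n)ᵀ * X n) with hG
  set a : ℕ → Fin p → ℝ := fun n => (G n)⁻¹ *ᵥ Pi.single j 1 with ha
  have hak : ∀ k, Tendsto (fun n => a n k) atTop (𝓝 (C⁻¹ k j)) := by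
    intro k
    simp only [ha, Matrix.mulVec_single_one, Matrix.col_apply]
    exact tendsto_pi_nhds.1 (tendsto_pi_nhds.1 hX.tendsto_inv k) j
  have hCj : 0 < C⁻¹ j j := hX.1.inv.diag_pos
  have hdet : ∀ᶠ n in atTop, 0 < (G n).det :=
    (((continuous_id.matrix_det).tendsto C).comp hX.2.1).eventually_const_lt hX.1.det_pos
  -- The quotient is the first-order threshold divided by the standard deviation `σ √(n a j)`; its
  -- convergence gives a bound uniform in large `n`.
  obtain ⟨M, hM⟩ : ∃ M : ℝ, ∀ᶠ n : ℕ in atTop,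
      (lam n / √(n : ℝ) + eta n / √(n : ℝ)) * (∑ k, |a n k|) / 2 / (σ * √(a n j)) ≤ M := by
    have h1 : Tendsto (fun n : ℕ =>
        (lam n / √(n : ℝ) + eta n / √(n : ℝ)) * (∑ k, |a n k|) / 2 / (σ * √(a n j))) atTop
        (𝓝 ((l + e) * (∑ k, |C⁻¹ k j|) / 2 / (σ * √(C⁻¹ j j)))) := by
      refine Tendsto.div (((hl.add he).mul (tendsto_finsetSum _ fun k _ => (hak k).abs)).div_const _)
        ((hak j).sqrt.const_mul _) ?_
      have := Real.sqrt_pos.2 hCj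
      positivity
    exact ⟨_, h1.eventually_le_const (lt_add_one _)⟩
  refine ⟨gaussianReal 0 1 {x | |x| ≤ M}, gaussianReal_Icc_lt_one M, ?_⟩
  refine limsup_le_of_le (by isBoundedDefault) ?_
  filter_upwards [hM, hdet, (hak j).eventually_const_lt hCj, eventually_gt_atTop 0]
    with n hMn hdetn haj hn
  have hn' : (0 : ℝ) < n := Nat.cast_pos.2 hn
  have hs : 0 < √(n : ℝ) := Real.sqrt_pos.2 hn'
  -- Used twice: with `d = a n` it gives the variance, and with `d = βhat - βstar` the error term,
  -- which vanishes when `j` is excluded.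
  have hgram : ∀ d : Fin p → ℝ, (X n *ᵥ d) ⬝ᵥ (X n *ᵥ a n) = n * d j := by
    intro d
    have e1 : ((X n)ᵀ * X n) *ᵥ a n = (n : ℝ) • Pi.single j 1 := by
      have e2 : G n *ᵥ a n = Pi.single j 1 := by
        rw [ha, Matrix.mulVec_mulVec, Matrix.mul_nonsing_inv _ (isUnit_iff_ne_zero.2 hdetn.ne'),
          Matrix.one_mulVec]
      rw [← e2, hG, Matrix.smul_mulVec, smul_smul, mul_one_div_cancel hn'.ne', one_smul]
    rw [← Matrix.vecMul_transpose, ← Matrix.dotProduct_mulVec, Matrix.mulVec_mulVec, e1]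
    simp [mul_comm]
  have hlaw := (hε n).hasLaw_dotProduct (X n *ᵥ a n)
  rw [hgram] at hlaw
  set B := (lam n + eta n) * (∑ k, |a n k|) / 2 with hB
  have hmB : MeasurableSet {x : ℝ | |x| ≤ B} := measurableSet_le (by fun_prop) (by fun_prop)
  have hv : σ ^ 2 * (n * a n j).toNNReal ≠ 0 := by
    have : 0 < (n * a n j).toNNReal := Real.toNNReal_pos.2 (by positivity)
    positivity
  calc P {ω | activeSet (βhat n ω) = activeSet βstar}
      ≤ P ((fun ω => ε n ω ⬝ᵥ (X n *ᵥ a n)) ⁻¹' {x | |x| ≤ B}) := by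
        refine measure_mono fun ω hω => ?_
        have hbj : βhat n ω j = 0 := by
          have h1 : j ∉ activeSet (βhat n ω) := by
            rw [Set.mem_ofPred_eq] at hω
            rw [hω]
            simp [activeSet, hj]
          simpa [activeSet] using h1
        have h2 := (hβhat n ω).two_mul_abs_dotProduct_le hn (hlam n) (heta n) (a n)
        have e1 : y n ω - X n *ᵥ βhat n ω = ε n ω - X n *ᵥ (βhat n ω - βstar) := by
          rw [hy, Matrix.mulVec_sub]; abel
        rw [e1, sub_dotProduct, hgram, Pi.sub_apply, hbj, hj, sub_zero, mul_zero, sub_zero] at h2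
        simp only [Set.mem_preimage, Set.mem_ofPred_eq]
        linarith
    _ = gaussianReal 0 (σ ^ 2 * (n * a n j).toNNReal) {x | |x| ≤ B} := by
        rw [← Measure.map_apply_of_aemeasurable hlaw.aemeasurable hmB, hlaw.map_eq]
    _ = gaussianReal 0 1 {x | |x| ≤ B / √((σ ^ 2 * (n * a n j).toNNReal : ℝ≥0) : ℝ)} :=
        gaussianReal_zero_abs_le hv B
    _ ≤ gaussianReal 0 1 {x | |x| ≤ M} := by
        refine measure_mono fun x (hx : |x| ≤ _) => hx.trans (le_trans (le_of_eq ?_) hMn)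
        have h0 : 0 ≤ (n : ℝ) * a n j := by positivity
        have hq : 0 < √(a n j) := Real.sqrt_pos.2 haj
        have hσ' : (0 : ℝ) < σ := NNReal.coe_pos.2 hσ
        rw [NNReal.coe_mul, Real.coe_toNNReal _ h0, NNReal.coe_pow, Real.sqrt_mul (by positivity),
          Real.sqrt_sq hσ'.le, Real.sqrt_mul hn'.le, hB]
        field_simp

theorem mainTheorem7
    {Ω Ω' : Type*} [MeasurableSpace Ω] [MeasurableSpace Ω']
    (P : Measure Ω) [IsProbabilityMeasure P] (P' : Measure Ω') [IsProbabilityMeasure P']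
    (p : ℕ) (βstar : Fin p → ℝ) (σ : ℝ≥0) (hσ : 0 < σ)
    -- design, noise, and response `y = X βstar + ε` for every target sample size `n`
    (X : (n : ℕ) → Matrix (Fin n) (Fin p) ℝ) (C : Matrix (Fin p) (Fin p) ℝ)
    (hX : DesignCondition X C)
    (ε : (n : ℕ) → Ω → Fin n → ℝ) (hε : ∀ n, IsIIDGaussianNoise P σ (ε n))
    (y : (n : ℕ) → Ω → Fin n → ℝ) (hy : ∀ n ω, y n ω = X n *ᵥ βstar + ε n ω)
    -- source sample size `m n` with `n / m n → r₀`
    (m : ℕ → ℕ) (hm : ∀ᶠ n in atTop, 0 < m n) (r₀ : ℝ) (hr₀ : 0 ≤ r₀)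
    (hmr : Tendsto (fun n : ℕ => (n : ℝ) / (m n : ℝ)) atTop (𝓝 r₀))
    -- initial estimator, independent of the target data, such that
    -- `√m (βinit - βstar)` converges in distribution to some random vector `Z`
    (βinit : ℕ → Ω → Fin p → ℝ) (hβinit : ∀ n, AEMeasurable (βinit n) P)
    (hindep : ∀ n, IndepFun (βinit n) (ε n) P)
    (Z : Ω' → Fin p → ℝ)
    (hZ : TendstoInDistribution
      (fun n ω => √(m n : ℝ) • (βinit n ω - βstar)) atTop Z (fun _ => P) P')
    -- the initial estimator is inconsistent in active variable selection
    (hinit : InconsistentActiveSelection P βinit βstar)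
    -- hyperparameters and the Transfer Lasso estimator
    (lam eta : ℕ → ℝ) (hlam : ∀ n, 0 ≤ lam n) (heta : ∀ n, 0 ≤ eta n)
    (βhat : ℕ → Ω → Fin p → ℝ)
    (hβhat : ∀ n ω, IsTransferLasso (X n) (y n ω) (lam n) (eta n) (βinit n ω) (βhat n ω)) :
    (RegimeI lam eta → InconsistentActiveSelection P βhat βstar) ∧
    (RegimeII lam eta → InconsistentActiveSelection P βhat βstar) := by
  obtain ⟨j, hj⟩ :=
    exists_inactive_of_inconsistent (tendsto_sqrt_sourceSize hm hr₀ hmr) hZ hinit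
  exact ⟨fun hI => hinit.of_tendsto_measure_ne
      (tendsto_measure_transferLasso_ne_init hX hε hy hm hr₀ hmr hZ hlam hβhat hI),
    fun hII => inconsistent_of_regimeII hσ hX hε hy hlam heta hβhat hII hj⟩
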